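/- Let $F$ be a differential field of characteristic zero (a field with a derivation $'$) whose field of constants $\{c\in F : c'=0\}$ is algebraically closed. A differential field extension $E$ of $F$ is called a \emph{no new constants} extension if every $c\in E$ with $c'=0$ lies in $F$. It is called an \emph{iterated antiderivative extension} of $F$ if it is a no new constants extension and $E=F(\zeta_1,\dots,\zeta_n)$ for finitely many elements $\zeta_1,\dots,\zeta_n\in E$ ($n\ge 0$) such that $\zeta_1'\in F$ and $\zeta_i'\in F(\zeta_1,\dots,\zeta_{i-1})$ for $2\le i\le n$. Theorem. Let $E$ be an iterated antiderivative extension of $F$ and let $K$ be a differential subfield of $E$ with $F\subseteq K\subseteq E$ (a subfield stable under the derivation). Then $K$ is an iterated antiderivative extension of $F$. -/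

import Mathlib

open scoped Differential

/-- The subfield of constants of a differential field: the kernel of the derivation. -/
def constantField (F : Type*) [Field F] [Differential F] : Subfield F where
  carrier := {x | x′ = 0}
  mul_mem' := by
    intro a b ha hb
    simp only [Set.mem_ofPred_eq] at ha hb ⊢
    rw [Derivation.leibniz, ha, hb]
    simp
  one_mem' := by simp
  add_mem' := by
    intro a b ha hb
    simp only [Set.mem_ofPred_eq] at ha hb ⊢
    rw [map_add, ha, hb, add_zero]
  zero_mem' := by simp
  neg_mem' := by
    intro a ha
    simp only [Set.mem_ofPred_eq] at ha ⊢
    rw [map_neg, ha, neg_zero]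
  inv_mem' := by
    intro a ha
    simp only [Set.mem_ofPred_eq] at ha ⊢
    rw [Derivation.leibniz_inv, ha, smul_zero]

section

variable {F E : Type*} [Field F] [Field E] [Differential E] [Algebra F E]

/-- An intermediate field `F ⊆ K ⊆ E` is a differential subfield of `E` if it is stable under the
derivation of `E`. -/
def IsDifferentialSubfield (K : IntermediateField F E) : Prop :=
  ∀ x ∈ K, x′ ∈ K

/-- The field `K`, `F ⊆ K ⊆ E`, is a no new constants extension of `F`: every constant in `K`
comes from `F`. -/
def IsNoNewConstants (K : IntermediateField F E) : Prop :=
  ∀ x ∈ K, x′ = 0 → x ∈ (algebraMap F E).range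

/-- The elements `ζ 0, …, ζ (n - 1)` of `E` are iterated antiderivatives of `F`: each derivative
`(ζ i)′` lies in the field `F(ζ 0, …, ζ (i - 1))`. -/
def AreIteratedAntiderivatives (F : Type*) {E : Type*} [Field F] [Field E] [Differential E]
    [Algebra F E] {n : ℕ} (ζ : Fin n → E) : Prop :=
  ∀ i : Fin n, (ζ i)′ ∈ IntermediateField.adjoin F (ζ '' Set.Iio i)

/-- The field `K`, `F ⊆ K ⊆ E`, is an iterated antiderivative extension of `F`: it is a no new
constants extension and `K = F(ζ 0, …, ζ (n - 1))` for finitely many iterated antiderivatives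
`ζ 0, …, ζ (n - 1)` of `F`. Such a `K` is automatically stable under the derivation of `E`. -/
def IsIteratedAntiderivativeExtension (K : IntermediateField F E) : Prop :=
  IsNoNewConstants K ∧
    ∃ (n : ℕ) (ζ : Fin n → E), AreIteratedAntiderivatives F ζ ∧
      K = IntermediateField.adjoin F (Set.range ζ)

end

/-! Choose in `K` a longest algebraically independent family `η` of iterated antiderivatives; the
transcendence degree of `E` bounds its length. If `K ≠ F(η)`, then
`IsAntiderivativeTower.exists_antiderivative` yields `r ∈ K` outside `F(η)` with `r′ ∈ F(η)`. By
`transcendental_of_deriv_mem` such an `r` is transcendental over `F(η)`, so `η` could be lengthened.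

The element `r` is found by induction along the tower from the base to `E`. When `x ∉ K` is adjoined
to the base `F`, induction gives `y ∈ K(x)` outside `F(x)` with `y′ ∈ F(x)`. No new constants means
that no irreducible monic polynomial divides its derivative, so the poles of `y` are among those of
`y′`. Hence `y = N / B ^ k` with `B` over `F`, and the first coefficient of `N` from the top that is
not in `F` serves as `r`. -/

/-! ### Derivations of `K[X]` with `X′ = t` in `K` -/

open Polynomial in
theorem natDegree_implicitDeriv_le {K : Type*} [Field K] [Differential K] (t : K) (p : K[X]) :
    (Differential.implicitDeriv (C t) p).natDegree ≤ p.natDegree := by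
  rw [natDegree_le_iff_coeff_eq_zero]
  intro i hi
  have h1 : p.coeff i = 0 := coeff_eq_zero_of_natDegree_lt hi
  have h2 : p.coeff (i + 1) = 0 := coeff_eq_zero_of_natDegree_lt (by omega)
  simp [Differential.implicitDeriv, coeff_derivative, h1, h2]

open Polynomial in
theorem coeff_natDegree_implicitDeriv {K : Type*} [Field K] [Differential K] (t : K) (p : K[X]) :
    (Differential.implicitDeriv (C t) p).coeff p.natDegree = p.leadingCoeff′ := by
  simp [Differential.implicitDeriv, coeff_derivative]

-- In top degree only the leading coefficient is differentiated, and here it is `1`.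
open Polynomial in
theorem Polynomial.Monic.degree_implicitDeriv_lt {K : Type*} [Field K] [Differential K] (t : K)
    {p : K[X]} (hp : p.Monic) : (Differential.implicitDeriv (C t) p).degree < p.degree := by
  rw [degree_eq_natDegree hp.ne_zero, degree_lt_iff_coeff_zero]
  intro i hi
  obtain rfl | hi := hi.eq_or_lt
  · rw [coeff_natDegree_implicitDeriv, hp.leadingCoeff]
    simp
  · exact coeff_eq_zero_of_natDegree_lt ((natDegree_implicitDeriv_le t p).trans_lt hi)

open Polynomial in
theorem exists_dvd_pow_of_forall_irreducible_dvd {K : Type*} [Field K] {B : K[X]} (D : K[X])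
    (hD : D ≠ 0) (h : ∀ p : K[X], p.Monic → Irreducible p → p ∣ D → p ∣ B) :
    ∃ k : ℕ, D ∣ B ^ k := by
  classical
  induction D using WfDvdMonoid.induction_on_irreducible with
  | zero => exact absurd rfl hD
  | unit u hu => exact ⟨0, by simpa using hu.dvd⟩
  | mul a p ha hp ih =>
    obtain ⟨k, hk⟩ := ih ha fun q hq hqi hqa ↦ h q hq hqi (hqa.mul_left p)
    have hpB : normalize p ∣ B :=
      h _ (monic_normalize hp.ne_zero) ((associated_normalize p).irreducible hp)
        ((normalize_dvd_iff.2 dvd_rfl).mul_right a)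
    refine ⟨k + 1, ?_⟩
    rw [pow_succ, mul_comm]
    exact mul_dvd_mul hk (normalize_dvd_iff.1 hpB)

open Polynomial in
/-- The denominator of an element of `K(x)` whose derivative has denominator `B` divides a power of
`B`. -/
theorem dvd_pow_of_wronskian_eq {K : Type*} [Field K] [CharZero K] (δ : Derivation ℤ K[X] K[X])
    (hδ : ∀ p : K[X], p.Monic → Irreducible p → ¬ p ∣ δ p) {N D A B : K[X]} (hD : D ≠ 0)
    (hco : IsCoprime N D) (h : (δ N * D - N * δ D) * B = A * D ^ 2) :
    ∃ k : ℕ, D ∣ B ^ k := by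
  -- Modulo `D` the hypothesis reads `N * δ D * B = 0`, and `N` is invertible.
  have hDB : D ∣ δ D * B := by
    refine hco.symm.dvd_of_dvd_mul_left ⟨δ N * B - A * D, ?_⟩
    linear_combination -h
  refine exists_dvd_pow_of_forall_irreducible_dvd D hD fun p hpm hp hpD ↦ ?_
  obtain ⟨m, hk, hm⟩ :=
    (FiniteMultiplicity.of_not_isUnit hp.not_isUnit hD).exists_eq_pow_mul_and_not_dvd
  generalize multiplicity p D = k at hk
  subst hk
  obtain _ | k := k
  · exact absurd (by simpa using hpD) hm
  have h1 : p ^ (k + 1) * m ∣ p ^ k * (((k + 1 : ℕ) : K[X]) * m * δ p * B + p * δ m * B) := by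
    refine hDB.trans (dvd_of_eq ?_)
    simp only [Derivation.leibniz, Derivation.leibniz_pow, smul_eq_mul, nsmul_eq_mul,
      Nat.add_sub_cancel]
    ring
  rw [pow_succ, mul_assoc] at h1
  have h2 := (dvd_mul_right p m).trans ((mul_dvd_mul_iff_left (pow_ne_zero k hp.ne_zero)).1 h1)
  have h3 : p ∣ ((k + 1 : ℕ) : K[X]) * m * δ p * B :=
    (dvd_add_left ((dvd_mul_right p (δ m)).mul_right B)).1 h2
  -- Characteristic zero: the multiplicity of `p` in `D` is a unit.
  have hk : IsUnit ((k + 1 : ℕ) : K[X]) := by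
    rw [← C_eq_natCast]
    exact isUnit_C.2 (Nat.cast_ne_zero.2 k.succ_ne_zero).isUnit
  rcases hp.prime.dvd_or_dvd h3 with h4 | h4
  · rcases hp.prime.dvd_or_dvd h4 with h5 | h5
    · rcases hp.prime.dvd_or_dvd h5 with h6 | h6
      · exact absurd (isUnit_of_dvd_unit h6 hk) hp.not_isUnit
      · exact absurd h6 hm
    · exact absurd h5 (hδ p hpm hp)
  · exact h4

open Polynomial in
theorem implicitDeriv_mem_lifts {K : Type*} [Field K] [Differential K] {F : Subfield K}
    (hF : ∀ a ∈ F, a′ ∈ F) {t : K} (ht : t ∈ F) {p : K[X]} (hp : p ∈ lifts F.subtype) :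
    Differential.implicitDeriv (C t) p ∈ lifts F.subtype := by
  rw [lifts_iff_coeff_lifts] at hp ⊢
  simp only [Subfield.coe_subtype, Subtype.range_coe_subtype, Set.mem_ofPred_eq] at hp ⊢
  intro n
  simp only [Differential.implicitDeriv, Derivation.coe_add, Derivation.coe_smul, Pi.add_apply,
    Pi.smul_apply, Derivation.restrictScalars_apply, derivative'_apply, smul_eq_mul, coeff_add,
    Differential.coeff_mapCoeffs, coeff_C_mul, coeff_derivative]
  exact F.add_mem (hF _ (hp n))
    (F.mul_mem ht (F.mul_mem (hp _) (F.add_mem (natCast_mem F n) F.one_mem)))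

open Polynomial in
/-- If the derivative of `N / D`, with `D` monic over `F`, is a rational function over `F`, then
either `N` is defined over `F`, or a coefficient of `N` is an antiderivative of an element of `F`
outside of `F`. -/
theorem exists_antiderivative_or_mem_lifts {K : Type*} [Field K] [Differential K] {F : Subfield K}
    (hF : ∀ a ∈ F, a′ ∈ F) {t : K} (ht : t ∈ F) {D B : K[X]} (hDm : D.Monic) (hBm : B.Monic)
    (hD : D ∈ lifts F.subtype) (hB : B ∈ lifts F.subtype) (N : K[X])
    (h : (Differential.implicitDeriv (C t) N * D - N * Differential.implicitDeriv (C t) D) * B ∈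
      lifts F.subtype) :
    (∃ r : K, r ∉ F ∧ r′ ∈ F) ∨ N ∈ lifts F.subtype := by
  induction hn : N.support.card using Nat.strong_induction_on generalizing N with
  | _ n ih =>
    subst hn
    obtain rfl | hN := eq_or_ne N 0
    · exact .inr (zero_mem _)
    set δ := Differential.implicitDeriv (C t) with hδ
    -- As `D` is monic, `N * δ D` does not reach this degree.
    have hlc : ((δ N * D - N * δ D) * B).coeff (N.natDegree + D.natDegree + B.natDegree) =
        N.leadingCoeff′ := by
      have h1 : (N * δ D).coeff (N.natDegree + D.natDegree) = 0 := by
        refine coeff_eq_zero_of_degree_lt ?_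
        rw [degree_mul, Nat.cast_add, degree_eq_natDegree hN, ← degree_eq_natDegree hDm.ne_zero]
        exact WithBot.add_lt_add_left (by simp) (hDm.degree_implicitDeriv_lt t)
      have h2 : (δ N * D).coeff (N.natDegree + D.natDegree) = N.leadingCoeff′ := by
        rw [coeff_mul_add_eq_of_natDegree_le (natDegree_implicitDeriv_le t N) le_rfl,
          coeff_natDegree_implicitDeriv, coeff_natDegree, hDm.leadingCoeff, mul_one]
      rw [coeff_mul_add_eq_of_natDegree_le _ le_rfl, coeff_sub, h1, h2, coeff_natDegree,
        hBm.leadingCoeff, mul_one, sub_zero]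
      refine (natDegree_sub_le _ _).trans (max_le ?_ ?_)
      · exact natDegree_mul_le.trans (Nat.add_le_add_right (natDegree_implicitDeriv_le t N) _)
      · exact natDegree_mul_le.trans (Nat.add_le_add_left (natDegree_implicitDeriv_le t D) _)
    by_cases hr : N.leadingCoeff ∈ F
    · have hmon : C N.leadingCoeff * X ^ N.natDegree ∈ lifts F.subtype :=
        mul_mem (C'_mem_lifts ⟨⟨_, hr⟩, rfl⟩) (X_pow_mem_lifts _ _)
      have hmon' : δ (C N.leadingCoeff * X ^ N.natDegree) ∈ lifts F.subtype :=
        implicitDeriv_mem_lifts hF ht hmon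
      have hD' : δ D ∈ lifts F.subtype := implicitDeriv_mem_lifts hF ht hD
      -- The expression is additive in `N`, so a leading term over `F` can be split off.
      have key : (δ N.eraseLead * D - N.eraseLead * δ D) * B ∈ lifts F.subtype := by
        rw [lifts_iff_liftsRing] at *
        have := sub_mem h (mul_mem (sub_mem (mul_mem hmon' hD) (mul_mem hmon hD')) hB)
        convert this using 1
        conv_rhs => rw [← N.eraseLead_add_C_mul_X_pow]
        simp only [eraseLead_add_C_mul_X_pow]
        have e := congrArg δ N.eraseLead_add_C_mul_X_pow
        rw [map_add] at e
        linear_combination (D * B) * e - (δ D * B) * N.eraseLead_add_C_mul_X_pow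
      rcases ih _ (eraseLead_support_card_lt hN) _ key rfl with h1 | h1
      · exact .inl h1
      · right
        rw [← N.eraseLead_add_C_mul_X_pow]
        exact add_mem h1 hmon
    · refine .inl ⟨_, hr, ?_⟩
      rw [lifts_iff_coeff_lifts] at h
      obtain ⟨a, ha⟩ := h (N.natDegree + D.natDegree + B.natDegree)
      rw [← hlc, ← ha]
      exact a.2

/-! ### Differential subfields and simple extensions -/

/-- The derivation induced on a differentially stable subfield. -/
@[reducible]
def Subfield.differential {E : Type*} [Field E] [Differential E] (K : Subfield E)
    (hK : ∀ a ∈ K, a′ ∈ K) : Differential K where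
  deriv := Derivation.mk'
    { toFun := fun a ↦ ⟨(a : E)′, hK a a.2⟩
      map_add' := fun a b ↦ Subtype.ext (by simp)
      map_smul' := fun n a ↦ Subtype.ext (by simp) }
    fun a b ↦ Subtype.ext (by simp)

theorem Subfield.differentialAlgebra {E : Type*} [Field E] [Differential E] (K : Subfield E)
    (hK : ∀ a ∈ K, a′ ∈ K) :
    letI := K.differential hK
    DifferentialAlgebra K E :=
  letI := K.differential hK
  ⟨fun _ ↦ rfl⟩

/-- The subfield `F(x)` of `E`. -/
def Subfield.adjoinSimple {E : Type*} [Field E] (F : Subfield E) (x : E) : Subfield E :=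
  Subfield.closure (insert x F)

theorem Subfield.le_adjoinSimple {E : Type*} [Field E] (F : Subfield E) (x : E) :
    F ≤ F.adjoinSimple x :=
  fun _ h ↦ Subfield.subset_closure (Set.mem_insert_of_mem _ h)

theorem Subfield.mem_adjoinSimple_self {E : Type*} [Field E] (F : Subfield E) (x : E) :
    x ∈ F.adjoinSimple x :=
  Subfield.subset_closure (Set.mem_insert _ _)

theorem Subfield.adjoinSimple_le {E : Type*} [Field E] {F G : Subfield E} {x : E}
    (h : F ≤ G) (hx : x ∈ G) : F.adjoinSimple x ≤ G :=
  Subfield.closure_le.2 (Set.insert_subset hx h)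

open Polynomial in
theorem Subfield.mem_adjoinSimple_iff {E : Type*} [Field E] {F : Subfield E} {x y : E} :
    y ∈ F.adjoinSimple x ↔ ∃ a b : F[X], y = aeval x a / aeval x b := by
  rw [← IntermediateField.mem_adjoin_simple_iff]
  have h : (IntermediateField.adjoin F {x}).toSubfield = F.adjoinSimple x := by
    change Subfield.closure (Set.range (algebraMap F E) ∪ {x}) = _
    rw [Set.union_singleton, Subfield.adjoinSimple]
    congr 2
    exact Subtype.range_coe
  rw [← h]
  rfl

theorem Subfield.deriv_mem_closure {E : Type*} [Field E] [Differential E] {s : Set E}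
    (hs : ∀ a ∈ s, a′ ∈ Subfield.closure s) {a : E} (ha : a ∈ Subfield.closure s) :
    a′ ∈ Subfield.closure s := by
  induction ha using Subfield.closure_induction with
  | mem a h => exact hs a h
  | one => simp
  | add a b _ _ ha hb => rw [map_add]; exact add_mem ha hb
  | neg a _ ha => rw [map_neg]; exact neg_mem ha
  | inv a ha' ha =>
    rw [Derivation.leibniz_inv]
    simp only [smul_eq_mul]
    exact mul_mem (neg_mem (pow_mem (inv_mem ha') 2)) ha
  | mul a b ha' hb' ha hb =>
    rw [Derivation.leibniz]
    exact add_mem (mul_mem ha' hb) (mul_mem hb' ha)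

theorem Subfield.deriv_mem_adjoinSimple {E : Type*} [Field E] [Differential E] {F : Subfield E}
    (hF : ∀ a ∈ F, a′ ∈ F) {x : E} (hx : x′ ∈ F) :
    ∀ a ∈ F.adjoinSimple x, a′ ∈ F.adjoinSimple x := by
  refine fun a ha ↦ Subfield.deriv_mem_closure ?_ ha
  rintro b (rfl | hb)
  · exact F.le_adjoinSimple b hx
  · exact F.le_adjoinSimple x (hF b hb)

/-! ### Adjoining one antiderivative -/

open Polynomial in
/-- An antiderivative of an element of `K` outside of `K` is transcendental over `K`, if there are
no new constants. -/
theorem transcendental_of_deriv_mem {E : Type*} [Field E] [CharZero E] [Differential E]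
    {K : Subfield E} (hK : ∀ a ∈ K, a′ ∈ K) (hC : ∀ c : E, c′ = 0 → c ∈ K) {x : E} (hx : x ∉ K)
    (hx' : x′ ∈ K) : Transcendental K x := by
  intro halg
  let := K.differential hK
  have := K.differentialAlgebra hK
  have hmon := minpoly.monic halg.isIntegral
  set p := minpoly K x with hp
  -- It vanishes at `x` and has smaller degree than the minimal polynomial.
  have hder : Differential.implicitDeriv (C (⟨x′, hx'⟩ : K)) p = 0 := by
    refine Polynomial.eq_zero_of_dvd_of_degree_lt (minpoly.dvd K x ?_)
      (hmon.degree_implicitDeriv_lt _)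
    rw [← Differential.deriv_aeval_eq_implicitDeriv x _ (by rw [aeval_C]; rfl), minpoly.aeval,
      map_zero]
  have hpos : 0 < p.natDegree := minpoly.natDegree_pos halg.isIntegral
  obtain ⟨n, hn⟩ := Nat.exists_eq_succ_of_ne_zero hpos.ne'
  have hcoeff := congrArg (fun q ↦ ((q.coeff n : K) : E)) hder
  have hlead : p.coeff (n + 1) = 1 := by rw [← Nat.succ_eq_add_one, ← hn]; exact hmon
  simp only [Differential.implicitDeriv, Derivation.coe_add, Derivation.coe_smul, Pi.add_apply,
    Pi.smul_apply, Derivation.restrictScalars_apply, derivative'_apply, smul_eq_mul, coeff_add,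
    Differential.coeff_mapCoeffs, coeff_C_mul, coeff_derivative, hlead, coeff_zero] at hcoeff
  have hcoeff : ((p.coeff n : K) : E)′ + x′ * ((n : E) + 1) = 0 := by
    have h : (((p.coeff n)′ : K) : E) = ((p.coeff n : K) : E)′ := rfl
    simpa [h] using hcoeff
  have hn0 : ((n : E) + 1) ≠ 0 := Nat.cast_add_one_ne_zero n
  -- This constant lies in `K`, so solving for `x` puts `x` in `K`.
  have hconst : (((p.coeff n : K) : E) + (n + 1 : ℕ) * x)′ = 0 := by
    rw [map_add, Derivation.leibniz, Derivation.map_natCast]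
    simp only [smul_eq_mul, mul_zero, add_zero, Nat.cast_add, Nat.cast_one]
    linear_combination hcoeff
  have h1 := K.sub_mem (hC _ hconst) (p.coeff n).2
  rw [add_sub_cancel_left] at h1
  have h2 := K.mul_mem (K.inv_mem (natCast_mem K (n + 1))) h1
  rw [inv_mul_cancel_left₀ (by exact_mod_cast hn0)] at h2
  exact hx h2

open Polynomial in
/-- If `x` is an antiderivative of an element of `F` and is transcendental over `K`, then any
antiderivative in `K(x)` of an element of `F(x)` lies in `F(x)`, unless `K` contains an
antiderivative of an element of `F` outside of `F`. -/
theorem exists_antiderivative_of_mem_adjoinSimple {E : Type*} [Field E] [CharZero E]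
    [Differential E] {F K : Subfield E} (hFK : F ≤ K) (hF : ∀ a ∈ F, a′ ∈ F)
    (hK : ∀ a ∈ K, a′ ∈ K) (hC : ∀ c : E, c′ = 0 → c ∈ F) {x : E} (hx : x ∉ K) (hx' : x′ ∈ F)
    {y : E} (hy : y ∈ K.adjoinSimple x) (hy' : y′ ∈ F.adjoinSimple x)
    (hyF : y ∉ F.adjoinSimple x) : ∃ r ∈ K, r ∉ F ∧ r′ ∈ F := by
  have htr : Transcendental K x :=
    transcendental_of_deriv_mem hK (fun c hc ↦ hFK (hC c hc)) hx (hFK hx')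
  let := K.differential hK
  have := K.differentialAlgebra hK
  have hinj : Function.Injective (aeval x : K[X] →ₐ[K] E) := transcendental_iff_injective.1 htr
  have hne : ∀ {p : K[X]}, p ≠ 0 → aeval x p ≠ 0 := fun hp h ↦ hp (hinj (by rw [h, map_zero]))
  set t : K := ⟨x′, hFK hx'⟩ with ht
  set δ := Differential.implicitDeriv (C t) with hδ
  have hder (p : K[X]) : (aeval x p)′ = aeval x (δ p) :=
    Differential.deriv_aeval_eq_implicitDeriv x _ (by rw [aeval_C]; rfl) p
  let F' : Subfield K := F.comap K.subtype
  have hF' : ∀ a ∈ F', a′ ∈ F' := fun a ha ↦ hF a ha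
  let ι : F →+* K := Subfield.inclusion hFK
  have hι (a : F[X]) : a.map ι ∈ lifts F'.subtype := by
    rw [lifts_iff_coeff_lifts]
    intro n
    rw [coeff_map]
    exact ⟨⟨ι (a.coeff n), (a.coeff n).2⟩, rfl⟩
  have hιx (a : F[X]) : aeval x (a.map ι) = aeval x a := by
    rw [aeval_def, aeval_def, eval₂_map]
    rfl
  have hlift {p : K[X]} (hp : p ∈ lifts F'.subtype) : aeval x p ∈ F.adjoinSimple x := by
    obtain ⟨q, rfl⟩ := (mem_lifts _).1 hp
    let j : F' →+* F := (K.subtype.comp F'.subtype).codRestrict F fun a ↦ a.2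
    refine Subfield.mem_adjoinSimple_iff.2 ⟨q.map j, 1, ?_⟩
    rw [map_one, div_one, aeval_def, aeval_def, eval₂_map, eval₂_map]
    rfl
  -- write `y = N / D` in lowest terms and `y′ = A / B` with `B` monic
  obtain ⟨N₀, D₀, hyND₀⟩ := Subfield.mem_adjoinSimple_iff.1 hy
  have hy0 : y ≠ 0 := fun h ↦ hyF (h ▸ zero_mem _)
  have hD₀ : D₀ ≠ 0 := by
    rintro rfl
    simp [hy0] at hyND₀
  obtain ⟨A, B, hAB, hBm, hA, hB⟩ : ∃ A B : K[X], y′ = aeval x A / aeval x B ∧ B.Monic ∧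
      A ∈ lifts F'.subtype ∧ B ∈ lifts F'.subtype := by
    obtain ⟨a, b, hab⟩ := Subfield.mem_adjoinSimple_iff.1 hy'
    -- Division by zero gives `y′ = 0`, which is `0 / 1`.
    by_cases hb : b = 0
    · refine ⟨0, 1, ?_, monic_one, zero_mem _, one_mem _⟩
      simp [hab, hb]
    · refine ⟨(C b.leadingCoeff⁻¹ * a).map ι, (C b.leadingCoeff⁻¹ * b).map ι, ?_, ?_, hι _, hι _⟩
      · have : algebraMap F E b.leadingCoeff⁻¹ ≠ 0 := by simpa using hb
        rw [hab, hιx, hιx, map_mul, map_mul, aeval_C, mul_div_mul_left _ _ this]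
      · refine Monic.map _ ?_
        rw [mul_comm]
        exact monic_mul_leadingCoeff_inv hb
  obtain ⟨N₁, D, hco, hyND, hD⟩ : ∃ N D : K[X], IsCoprime N D ∧ y = aeval x N / aeval x D ∧
      D ≠ 0 := by
    obtain ⟨N, D, g, hco, rfl, rfl⟩ := UniqueFactorizationMonoid.exists_reduced_factors' N₀ D₀ hD₀
    have hg : g ≠ 0 := left_ne_zero_of_mul hD₀
    refine ⟨N, D, hco.isCoprime, ?_, right_ne_zero_of_mul hD₀⟩
    rw [hyND₀, map_mul, map_mul, mul_div_mul_left _ _ (hne hg)]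
  -- The quotient rule, needed both for the reduced fraction and for denominator `B ^ k`.
  have hquot {N D : K[X]} (hD : D ≠ 0) (h : y = aeval x N / aeval x D) :
      (δ N * D - N * δ D) * B = A * D ^ 2 := by
    apply hinj
    have h0 := hne hD
    have hB0 := hne hBm.ne_zero
    rw [eq_div_iff h0] at h
    have h' := congrArg (fun z ↦ z′) h
    simp only [Derivation.leibniz, smul_eq_mul, hder] at h'
    rw [eq_div_iff hB0] at hAB
    simp only [map_mul, map_sub, map_pow]
    linear_combination (aeval x B) * (-(aeval x D) * h' + aeval x (δ D) * h) + (aeval x D)^2 * hAB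
  -- Divisibility forces `δ p = 0` by degree; then `p(x)` is a constant of `E`, and `p` has degree
  -- zero since `x` is transcendental.
  have hirr : ∀ p : K[X], p.Monic → Irreducible p → ¬ p ∣ δ p := by
    intro p hpm hp hdvd
    have h0 : δ p = 0 := eq_zero_of_dvd_of_degree_lt hdvd (hpm.degree_implicitDeriv_lt t)
    have hc : aeval x p ∈ K := hFK (hC _ (by rw [hder, h0, map_zero]))
    have : p = C ⟨_, hc⟩ := hinj (by rw [aeval_C]; rfl)
    exact (Irreducible.natDegree_pos hp).ne' (by rw [this, natDegree_C])
  obtain ⟨k, m, hm⟩ := dvd_pow_of_wronskian_eq δ hirr hD hco (hquot hD hyND)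
  have hBk : (B ^ k).Monic := hBm.pow k
  have hm0 : m ≠ 0 := fun h ↦ hBk.ne_zero (by rw [hm, h, mul_zero])
  have hyB : y = aeval x (N₁ * m) / aeval x (B ^ k) := by
    rw [hyND, hm, map_mul, map_mul, mul_div_mul_right _ _ (hne hm0)]
  have hBk' : B ^ k ∈ lifts F'.subtype := pow_mem hB k
  rcases exists_antiderivative_or_mem_lifts hF' (t := t) hx' hBk hBm hBk' hB (N₁ * m)
    (by rw [hquot hBk.ne_zero hyB]; exact mul_mem hA (pow_mem hBk' 2)) with ⟨r, hr, hr'⟩ | h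
  · exact ⟨r, r.2, hr, hr'⟩
  · exact absurd (hyB ▸ div_mem (hlift h) (hlift hBk')) hyF

/-! ### Towers of antiderivatives -/

/-- `E` is obtained from the subfield `F` by finitely many adjunctions of antiderivatives. -/
inductive IsAntiderivativeTower {E : Type*} [Field E] [Differential E] : Subfield E → Prop
  | top : IsAntiderivativeTower ⊤
  | step (F : Subfield E) (x : E) (hx : x′ ∈ F) (h : IsAntiderivativeTower (F.adjoinSimple x)) :
      IsAntiderivativeTower F

theorem IsAntiderivativeTower.mono {E : Type*} [Field E] [Differential E] {F G : Subfield E}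
    (h : IsAntiderivativeTower F) (hFG : F ≤ G) : IsAntiderivativeTower G := by
  induction h generalizing G with
  | top => exact top_le_iff.1 hFG ▸ .top
  | step F x hx _ ih =>
    exact .step G x (hFG hx) (ih (Subfield.adjoinSimple_le (hFG.trans (G.le_adjoinSimple x))
      (G.mem_adjoinSimple_self x)))

-- If `u = a(x) / b(x)`, then `u * b = a` already in `K[X]`, and comparing coefficients at the
-- degree of `b` exhibits `u` as a quotient in `F`.
open Polynomial in
theorem Subfield.le_of_le_adjoinSimple {E : Type*} [Field E] {F K : Subfield E}
    (hFK : F ≤ K) {x : E} (hx : Transcendental K x) (h : K ≤ F.adjoinSimple x) : K ≤ F := by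
  intro u hu
  obtain ⟨a, b, hab⟩ := Subfield.mem_adjoinSimple_iff.1 (h hu)
  by_cases hb : aeval x b = 0
  · rw [hab, hb, div_zero]
    exact zero_mem F
  rw [eq_div_iff hb] at hab
  let ι : F →+* K := Subfield.inclusion hFK
  have hιx (a : F[X]) : aeval x (a.map ι) = aeval x a := by
    rw [aeval_def, aeval_def, eval₂_map]
    rfl
  have key : C (⟨u, hu⟩ : K) * b.map ι = a.map ι := by
    apply transcendental_iff_injective.1 hx
    rw [map_mul, hιx, hιx, aeval_C]
    exact hab
  have hb0 : b ≠ 0 := by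
    rintro rfl
    simp at hb
  have hlc := congrArg (fun p ↦ ((p.coeff b.natDegree : K) : E)) key
  simp only [coeff_C_mul, coeff_map] at hlc
  have hlc : u * (b.leadingCoeff : E) = (a.coeff b.natDegree : E) := hlc
  have hne : (b.leadingCoeff : E) ≠ 0 := by simpa using hb0
  rw [← eq_div_iff hne] at hlc
  rw [hlc]
  exact div_mem (SetLike.coe_mem _) (SetLike.coe_mem _)

/-- A differential subfield strictly larger than `F` of a tower of antiderivatives over `F` without
new constants contains an antiderivative of an element of `F` outside of `F`. -/
theorem IsAntiderivativeTower.exists_antiderivative {E : Type*} [Field E] [CharZero E]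
    [Differential E] {F K : Subfield E} (h : IsAntiderivativeTower F) (hF : ∀ a ∈ F, a′ ∈ F)
    (hC : ∀ c : E, c′ = 0 → c ∈ F) (hFK : F ≤ K) (hK : ∀ a ∈ K, a′ ∈ K) (hKF : ¬ K ≤ F) :
    ∃ r ∈ K, r ∉ F ∧ r′ ∈ F := by
  induction h generalizing K with
  | top => exact absurd le_top hKF
  | step F x hx _ ih =>
    by_cases hxK : x ∈ K
    -- A tower step may be trivial; then `F(x) = F`.
    · by_cases hxF : x ∈ F
      · have e : F.adjoinSimple x = F :=
          le_antisymm (Subfield.adjoinSimple_le le_rfl hxF) (F.le_adjoinSimple x)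
        rw [e] at ih
        exact ih hF hC hFK hK hKF
      · exact ⟨x, hxK, hxF, hx⟩
    · by_cases hL : K.adjoinSimple x ≤ F.adjoinSimple x
      · have htr := transcendental_of_deriv_mem hK (fun c hc ↦ hFK (hC c hc)) hxK (hFK hx)
        exact absurd (Subfield.le_of_le_adjoinSimple hFK htr ((K.le_adjoinSimple x).trans hL)) hKF
      · obtain ⟨y, hy, hyF, hy'⟩ := ih (Subfield.deriv_mem_adjoinSimple hF hx)
          (fun c hc ↦ F.le_adjoinSimple x (hC c hc))
          (Subfield.adjoinSimple_le (hFK.trans (K.le_adjoinSimple x)) (K.mem_adjoinSimple_self x))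
          (Subfield.deriv_mem_adjoinSimple hK (hFK hx)) hL
        exact exists_antiderivative_of_mem_adjoinSimple hFK hF hK hC hxK hx hy hy' hyF

/-! ### Families of iterated antiderivatives and the main theorem -/

/-- The fields generated by initial segments of iterated antiderivatives are differential
subfields. -/
theorem AreIteratedAntiderivatives.deriv_mem_adjoin {F E : Type*} [Field F] [Field E]
    [Differential F] [Differential E] [Algebra F E] [DifferentialAlgebra F E] {n : ℕ}
    {ζ : Fin n → E} (h : AreIteratedAntiderivatives F ζ) :
    ∀ a ∈ IntermediateField.adjoin F (Set.range ζ),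
      a′ ∈ IntermediateField.adjoin F (Set.range ζ) := by
  intro a ha
  refine Subfield.deriv_mem_closure ?_ ha
  rintro b (⟨c, rfl⟩ | ⟨i, rfl⟩)
  · rw [deriv_algebraMap]
    exact IntermediateField.algebraMap_mem (IntermediateField.adjoin F (Set.range ζ)) _
  · exact IntermediateField.adjoin.mono _ _ _ (Set.image_subset_range _ _) (h i)

/-- The same `ζ` are adjoined to the larger base `G`, which will be `F(η)`. -/
theorem AreIteratedAntiderivatives.isAntiderivativeTower {F E : Type*} [Field F] [Field E]
    [Differential E] [Algebra F E] {n : ℕ} {ζ : Fin n → E} (h : AreIteratedAntiderivatives F ζ)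
    (htop : IntermediateField.adjoin F (Set.range ζ) = ⊤) {G : Subfield E}
    (hG : (algebraMap F E).fieldRange ≤ G) : IsAntiderivativeTower G := by
  have key (k : ℕ) (hk : k ≤ n) :
      IsAntiderivativeTower (IntermediateField.adjoin F (ζ '' {i | i.1 < k})).toSubfield := by
    induction hk using Nat.decreasingInduction with
    | self =>
      have : ζ '' {i | i.1 < n} = Set.range ζ := by simp
      rw [this, htop]
      exact .top
    | of_succ k hk ih =>
      refine .step _ (ζ ⟨k, hk⟩) (h ⟨k, hk⟩) (ih.mono ?_)
      refine Subfield.closure_le.2 (Set.union_subset ?_ ?_)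
      · rintro _ ⟨a, rfl⟩
        exact Subfield.le_adjoinSimple _ _ (IntermediateField.algebraMap_mem _ a)
      · rintro _ ⟨i, hi, rfl⟩
        obtain hi | hi := (Nat.lt_succ_iff.1 hi).lt_or_eq
        · exact Subfield.le_adjoinSimple _ _
            (IntermediateField.subset_adjoin F _ ⟨i, hi, rfl⟩)
        · obtain rfl : i = ⟨k, hk⟩ := Fin.ext hi
          exact Subfield.mem_adjoinSimple_self _ _
  refine (key 0 n.zero_le).mono (Subfield.closure_le.2 (Set.union_subset ?_ ?_))
  · rintro _ ⟨a, rfl⟩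
    exact hG ⟨a, rfl⟩
  · rintro _ ⟨i, hi, rfl⟩
    exact absurd hi (Nat.not_lt_zero _)

theorem AreIteratedAntiderivatives.snoc {F E : Type*} [Field F] [Field E]
    [Differential E] [Algebra F E] {n : ℕ} {ζ : Fin n → E} (h : AreIteratedAntiderivatives F ζ)
    {y : E} (hy : y′ ∈ IntermediateField.adjoin F (Set.range ζ)) :
    AreIteratedAntiderivatives F (Fin.snoc ζ y : Fin (n + 1) → E) := by
  intro i
  refine Fin.lastCases ?_ (fun i ↦ ?_) i
  · rw [Fin.snoc_last]
    refine IntermediateField.adjoin.mono _ _ _ ?_ hy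
    rintro _ ⟨i, rfl⟩
    exact ⟨i.castSucc, Fin.castSucc_lt_last i, Fin.snoc_castSucc ..⟩
  · rw [Fin.snoc_castSucc]
    refine IntermediateField.adjoin.mono _ _ _ ?_ (h i)
    rintro _ ⟨j, hj, rfl⟩
    exact ⟨j.castSucc, Fin.castSucc_lt_castSucc_iff.2 hj, Fin.snoc_castSucc ..⟩

open scoped IntermediateField.algebraAdjoinAdjoin in
theorem AlgebraicIndependent.snoc {F E : Type*} [Field F] [Field E] [Algebra F E] {n : ℕ}
    {ζ : Fin n → E} (h : AlgebraicIndependent F ζ) {y : E}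
    (hy : Transcendental (IntermediateField.adjoin F (Set.range ζ)) y) :
    AlgebraicIndependent F (Fin.snoc ζ y : Fin (n + 1) → E) := by
  have h1 : Transcendental (Algebra.adjoin F (Set.range ζ)) y :=
    hy.restrictScalars (FaithfulSMul.algebraMap_injective _ _)
  have h2 := (algebraicIndependent_equiv finSuccEquivLast).2
    ((h.option_iff_transcendental y).2 h1)
  convert h2 using 1
  funext i
  refine Fin.lastCases ?_ (fun i ↦ ?_) i <;> simp

open scoped IntermediateField.algebraAdjoinAdjoin in
theorem trdeg_le_of_adjoin_range_eq_top {F E : Type*} [Field F] [Field E] [Algebra F E] {n : ℕ}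
    {ζ : Fin n → E} (h : IntermediateField.adjoin F (Set.range ζ) = ⊤) :
    Algebra.trdeg F E ≤ n := by
  have halg : Algebra.IsAlgebraic (Algebra.adjoin F (Set.range ζ)) E := by
    refine ⟨fun a ↦ ?_⟩
    have ha : a ∈ IntermediateField.adjoin F (Set.range ζ) := h ▸ trivial
    exact (Algebra.IsAlgebraic.isAlgebraic (R := Algebra.adjoin F (Set.range ζ))
      (⟨a, ha⟩ : IntermediateField.adjoin F (Set.range ζ))).algebraMap
  obtain ⟨t, ht, hb⟩ := exists_isTranscendenceBasis_subset (R := F) (Set.range ζ)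
  rw [← hb.cardinalMk_eq_trdeg]
  refine (Cardinal.mk_le_mk_of_subset ht).trans ?_
  simpa using Cardinal.mk_range_le_lift (f := ζ)

theorem mainTheorem1 {F E : Type*} [Field F] [Field E] [CharZero F]
    [Differential F] [Differential E] [Algebra F E] [DifferentialAlgebra F E]
    (hC : IsAlgClosed (constantField F))
    (hE : IsIteratedAntiderivativeExtension (⊤ : IntermediateField F E))
    (K : IntermediateField F E) (hK : IsDifferentialSubfield K) :
    IsIteratedAntiderivativeExtension K := by
  have : CharZero E := charZero_of_injective_algebraMap (algebraMap F E).injective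
  obtain ⟨hconst, n, ζ, hζ, htop⟩ := hE
  refine ⟨fun x _ hx ↦ hconst x trivial hx, ?_⟩
  -- Algebraic independence is what bounds the length `m`.
  let P (m : ℕ) : Prop := ∃ η : Fin m → E, AreIteratedAntiderivatives F η ∧
    AlgebraicIndependent F η ∧ ∀ i, η i ∈ K
  have hP0 : P 0 := ⟨Fin.elim0, fun i ↦ i.elim0,
    algebraicIndependent_empty_type_iff.2 (algebraMap F E).injective, fun i ↦ i.elim0⟩
  have hbound (m : ℕ) (hm : P m) : m ≤ n := by
    obtain ⟨η, -, hη, -⟩ := hm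
    have h1 := hη.lift_cardinalMk_le_trdeg
    have h2 := Cardinal.lift_le.2 (trdeg_le_of_adjoin_range_eq_top htop.symm)
    simpa using h1.trans h2
  classical
  obtain ⟨η, hη, hind, hηK⟩ := Nat.findGreatest_spec (P := P) n.zero_le hP0
  refine ⟨_, η, hη, ?_⟩
  have hle : IntermediateField.adjoin F (Set.range η) ≤ K :=
    IntermediateField.adjoin_le_iff.2 (Set.range_subset_iff.2 hηK)
  refine le_antisymm ?_ hle
  by_contra hKη
  set F' := IntermediateField.adjoin F (Set.range η) with hF'
  have hFF' : (algebraMap F E).fieldRange ≤ F'.toSubfield := by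
    rintro _ ⟨a, rfl⟩
    exact F'.algebraMap_mem a
  have hCF' (c : E) (hc : c′ = 0) : c ∈ F'.toSubfield := hFF' (hconst c trivial hc)
  obtain ⟨r, hrK, hrF, hr⟩ := (hζ.isAntiderivativeTower htop.symm hFF').exists_antiderivative
    hη.deriv_mem_adjoin hCF' (K := K.toSubfield) hle hK hKη
  have htr : Transcendental F' r :=
    transcendental_of_deriv_mem (K := F'.toSubfield) hη.deriv_mem_adjoin hCF' hrF hr
  have hsucc : P (Nat.findGreatest P n + 1) := by
    refine ⟨Fin.snoc η r, hη.snoc hr, hind.snoc htr, fun i ↦ ?_⟩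
    refine Fin.lastCases ?_ (fun i ↦ ?_) i
    · rwa [Fin.snoc_last]
    · rw [Fin.snoc_castSucc]
      exact hηK i
  exact (Nat.le_findGreatest (hbound _ hsucc) hsucc).not_gt (Nat.lt_succ_self _)
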